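/- Let $X \subset \mathbb{P}^N_{\mathbb{R}}$ be a real projective variety, that is, the set of common real zeros of a set of homogeneous polynomials in $\mathbb{R}[x_0,\dots,x_N]$, and assume that $X$ is nondegenerate, i.e. not contained in a hyperplane. Let $\hat X \subset \mathbb{R}^{N+1}$ be the cone over $X$. The $X$-rank of a point of $\mathbb{P}^N_{\mathbb{R}}$ represented by $v \in \mathbb{R}^{N+1}\setminus\{0\}$ is the minimal $k$ such that $v = \sum_{i=1}^k \lambda_i x_i$ with $\lambda_i \in \mathbb{R}$ and $x_i \in \hat X$. A nonnegative integer $r$ is a typical $X$-rank if the set of points of $\mathbb{P}^N_{\mathbb{R}}$ of $X$-rank exactly $r$ has nonempty interior in the Euclidean topology. Then there are a lowest typical $X$-rank and a highest typical $X$-rank, and every integer between them is also a typical $X$-rank. -/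

import Mathlib

open scoped LinearAlgebra.Projectivization

namespace RealRank

/-- The real vector space `ℝ^{N+1}`. -/
abbrev Vec (N : ℕ) : Type := Fin (N + 1) → ℝ

/-- The real projective space `ℙ^N`, the projectivization of `ℝ^{N+1}`. -/
abbrev ProjSpace (N : ℕ) : Type := ℙ ℝ (Vec N)

/-- The Euclidean topology on real projective space: the quotient topology along the canonical
map from the nonzero vectors of `ℝ^{N+1}`. -/
noncomputable instance instTopologicalSpaceProjSpace (N : ℕ) : TopologicalSpace (ProjSpace N) :=
  TopologicalSpace.coinduced
    (Projectivization.mk' ℝ : {v : Vec N // v ≠ 0} → ProjSpace N) inferInstance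

/-- A real projective variety: the common zero set in `ℙ^N` of a set of homogeneous
real polynomials in `N + 1` variables (not necessarily irreducible). -/
def IsProjectiveVariety {N : ℕ} (X : Set (ProjSpace N)) : Prop :=
  ∃ F : Set (MvPolynomial (Fin (N + 1)) ℝ),
    (∀ f ∈ F, ∃ d : ℕ, f.IsHomogeneous d) ∧
    ∀ (v : Vec N) (hv : v ≠ 0),
      Projectivization.mk ℝ v hv ∈ X ↔ ∀ f ∈ F, MvPolynomial.eval v f = 0

/-- The cone over `X` in `ℝ^{N+1}`: the origin together with all representatives of
points of `X`. -/
def cone {N : ℕ} (X : Set (ProjSpace N)) : Set (Vec N) :=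
  {v | ∀ hv : v ≠ 0, Projectivization.mk ℝ v hv ∈ X}

/-- `X` is nondegenerate: it is not contained in a hyperplane, i.e. no nonzero linear form
vanishes on the cone over `X`. -/
def IsNondegenerate {N : ℕ} (X : Set (ProjSpace N)) : Prop :=
  ∀ φ : Vec N →ₗ[ℝ] ℝ, φ ≠ 0 → ∃ v ∈ cone X, φ v ≠ 0

/-- `v` is a linear combination `∑ᵢ λᵢ xᵢ` of `k` elements of the cone over `X`. -/
def HasDecomposition {N : ℕ} (X : Set (ProjSpace N)) (k : ℕ) (v : Vec N) : Prop :=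
  ∃ (c : Fin k → ℝ) (x : Fin k → Vec N), (∀ i, x i ∈ cone X) ∧ v = ∑ i, c i • x i

/-- The `X`-rank of a vector: the minimal `k` for which it is a linear combination of `k`
elements of the cone over `X` (and `⊤` if there is no such `k`). -/
noncomputable def vecRank {N : ℕ} (X : Set (ProjSpace N)) (v : Vec N) : ℕ∞ :=
  ⨅ (k : ℕ) (_ : HasDecomposition X k v), (k : ℕ∞)

theorem HasDecomposition.smul {N : ℕ} {X : Set (ProjSpace N)} {k : ℕ} {v : Vec N}
    (h : HasDecomposition X k v) (t : ℝ) : HasDecomposition X k (t • v) := by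
  obtain ⟨c, x, hx, rfl⟩ := h
  exact ⟨fun i => t * c i, x, hx, by simp [Finset.smul_sum, mul_smul]⟩

theorem vecRank_smul_le {N : ℕ} (X : Set (ProjSpace N)) (t : ℝ) (v : Vec N) :
    vecRank X (t • v) ≤ vecRank X v :=
  le_iInf₂ fun k hk => iInf₂_le k (hk.smul t)

theorem vecRank_smul {N : ℕ} (X : Set (ProjSpace N)) {t : ℝ} (ht : t ≠ 0) (v : Vec N) :
    vecRank X (t • v) = vecRank X v := by
  refine le_antisymm (vecRank_smul_le X t v) ?_
  have h := vecRank_smul_le X t⁻¹ (t • v)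
  rwa [inv_smul_smul₀ ht] at h

/-- The `X`-rank of a point of `ℙ^N`: the `X`-rank of any vector representing it. -/
noncomputable def rank {N : ℕ} (X : Set (ProjSpace N)) (p : ProjSpace N) : ℕ∞ :=
  Projectivization.lift (fun v : {v : Vec N // v ≠ 0} => vecRank X v) (by
    intro a b t h
    have ht : t ≠ 0 := by
      rintro rfl
      exact a.2 (by simpa using h)
    simp only [h, vecRank_smul X ht]) p

/-- `r` is a typical `X`-rank: the set of points of `ℙ^N` of `X`-rank exactly `r` has
nonempty interior in the Euclidean topology. -/
def IsTypicalRank {N : ℕ} (X : Set (ProjSpace N)) (r : ℕ) : Prop :=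
  (interior {p : ProjSpace N | rank X p = (r : ℕ∞)}).Nonempty

end RealRank

/-!
Let `S k` be the set of vectors of rank at most `k`; the rank `r` is typical exactly when
`S r \ S (r - 1)` has nonempty interior in `ℝ^{N+1}` (`isTypicalRank_iff`, `vecRank_eq_iff`).

Suppose that `S k` has nonempty interior and that `k + 1` is not typical. If `x` lies in the cone,
then `interior (S k) + x` is an open subset of `S (k + 1)`, so it can leave the closure of
`interior (S k)` only on a negligible set, and hence not at all. Thus the closure of
`interior (S k)` is stable under translation by every vector of the cone. The cone spans
`ℝ^{N+1}`, so this closure is the whole space, and no rank above `k` is typical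
(`dense_interior_of_interior_diff_eq_empty`). This rules out gaps
(`exists_isLeast_isGreatest_of_filtration`).

The argument needs one tameness property: wherever `S k` is dense, so is its interior
(`interior_closure_image_subset`). It would follow from the theorem of Tarski and Seidenberg, but
`S k` is the image of a real algebraic set under a polynomial map, and for such an image there is a
more direct route: it is contained in the union of its interior and a hypersurface
(`exists_mem_interior_image_or_eval_eq_zero`). By Noetherian induction, only a prime ideal and the
points off some smaller zero set have to be treated. If the coordinates of the map are
algebraically dependent modulo the prime ideal, the image lies in a hypersurface. If they are
independent, they extend to a transcendence basis of the coordinate ring `R`; let `P` be the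
polynomial ring on this basis. The fraction field of `R` is generated over that of `P` by one
element `θ`, which is a simple root of its minimal polynomial `f`. At a general real point of `R`,
the value of `θ` is a simple root of the specialization of `f`, so a root remains when the point of
`P` moves slightly, by the intermediate value theorem. Since the coordinates are fractions in
`P` and `θ`, the real point of `R` moves along (`exists_extension_of_isAlgebraic`).
-/

namespace RealRank

open Filter Topology

/-! ### Lifting real points along algebraic extensions -/

section Lifting

open Polynomial

/-- A polynomial with a simple real root keeps a real root under small perturbations, as it changes
sign. -/
theorem eventually_exists_root {P U : Type*} [CommRing P] {l : Filter U} {χ : U → P →+* ℝ}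
    {χ₀ : P →+* ℝ} (hχ : ∀ p, Tendsto (fun u => χ u p) l (𝓝 (χ₀ p))) (f : P[X]) {a : ℝ}
    (ha : f.eval₂ χ₀ a = 0) (ha' : (derivative f).eval₂ χ₀ a ≠ 0) :
    ∀ᶠ u in l, ∃ b, f.eval₂ (χ u) b = 0 := by
  have hev : ∀ x : ℝ, Tendsto (fun u => f.eval₂ (χ u) x) l (𝓝 (f.eval₂ χ₀ x)) := by
    intro x
    simp only [Polynomial.eval₂_eq_sum_range]
    exact tendsto_finsetSum _ fun i _ => (hχ _).mul_const _
  have hd : HasDerivAt (fun x => f.eval₂ χ₀ x) ((derivative f).eval₂ χ₀ a) a := by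
    simpa [Polynomial.eval_map, derivative_map] using (f.map χ₀).hasDerivAt a
  obtain ⟨x, y, hxy⟩ : ∃ x y, f.eval₂ χ₀ x < 0 ∧ 0 < f.eval₂ χ₀ y := by
    by_contra! hcon
    have hmin : IsLocalExtr (fun x => f.eval₂ χ₀ x) a := by
      by_cases h : ∃ x, f.eval₂ χ₀ x < 0
      · obtain ⟨x, hx⟩ := h
        exact Or.inr (Eventually.of_forall fun y => by simpa [ha] using hcon x y hx)
      · push Not at h
        exact Or.inl (Eventually.of_forall fun y => by simpa [ha] using h y)
    exact ha' (hmin.hasDerivAt_eq_zero hd)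
  filter_upwards [(hev x).eventually_lt_const hxy.1, (hev y).eventually_const_lt hxy.2]
    with u hu hu'
  have hcont : Continuous fun z => f.eval₂ (χ u) z := by
    simpa [Polynomial.eval_map] using (f.map (χ u)).continuous
  exact mem_range_of_exists_le_of_exists_ge hcont ⟨x, hu.le⟩ ⟨y, hu'.le⟩

/-- A ring homomorphism from a domain `D` to a field extends to the local ring at its kernel,
seen as a subring `O` of a field `K` containing `D`. -/
theorem exists_extension_to_localSubring {D K k : Type*} [CommRing D] [Field K] [Field k]
    [Algebra D K] [FaithfulSMul D K] (ψ : D →+* k) :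
    ∃ (O : Subring K) (Ψ : O →+* k),
      (∀ d, ∃ h : algebraMap D K d ∈ O, Ψ ⟨algebraMap D K d, h⟩ = ψ d) ∧
      ∀ x : K, ∀ a b : D, ψ b ≠ 0 → x * algebraMap D K b = algebraMap D K a → x ∈ O := by
  have hp : (RingHom.ker ψ).IsPrime := RingHom.ker_isPrime ψ
  set M := (RingHom.ker ψ).primeCompl
  have hinj := FaithfulSMul.algebraMap_injective D K
  have hMK : ∀ y : M, IsUnit (algebraMap D K y) := fun y => by
    have hy : (y : D) ≠ 0 := fun h => y.2 (by rw [h]; exact Ideal.zero_mem _)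
    exact isUnit_iff_ne_zero.2 ((map_ne_zero_iff _ hinj).2 hy)
  have hMk : ∀ y : M, IsUnit (ψ y) := fun y => isUnit_iff_ne_zero.2 y.2
  let i : Localization M →+* K := IsLocalization.lift hMK
  have hi : Function.Injective i := by
    have : IsDomain D := hinj.isDomain (algebraMap D K)
    refine (IsLocalization.lift_injective_iff _).2 fun a b => ?_
    rw [hinj.eq_iff, (IsLocalization.injective (Localization M)
      (Ideal.primeCompl_le_nonZeroDivisors (RingHom.ker ψ))).eq_iff]
  let e := RingEquiv.ofLeftInverse (Function.leftInverse_invFun hi)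
  refine ⟨i.range, (IsLocalization.lift hMk).comp e.symm.toRingHom, fun d => ?_, fun x a b hb h => ?_⟩
  · have hd : i (algebraMap D _ d) = algebraMap D K d := IsLocalization.lift_eq hMK d
    refine ⟨⟨_, hd⟩, ?_⟩
    have : (⟨algebraMap D K d, ⟨_, hd⟩⟩ : i.range) = e (algebraMap D _ d) := Subtype.ext hd.symm
    rw [this]
    simp [IsLocalization.lift_eq]
  · refine ⟨IsLocalization.mk' _ a (⟨b, hb⟩ : M), ?_⟩
    rw [IsLocalization.lift_mk', h.symm]
    exact (Units.mul_inv_eq_iff_eq_mul _).2 rfl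

/-- Let `R` be a domain, of finite type and algebraic over an integrally closed subring `P`.
Then there is `s ≠ 0` such that each real point `φ` of `R` with `φ s ≠ 0` moves along with its
restriction to `P`: every real point of `P` close enough to `φ` extends to `R`. -/
theorem exists_extension_of_isAlgebraic {P R : Type*} [CommRing P] [IsDomain P] [CharZero P]
    [IsIntegrallyClosed P] [CommRing R] [IsDomain R] [Algebra P R] [FaithfulSMul P R]
    [Algebra.FiniteType P R] [Algebra.IsAlgebraic P R] :
    ∃ s : R, s ≠ 0 ∧ ∀ φ : R →+* ℝ, φ s ≠ 0 → ∀ {U : Type} {l : Filter U} {χ : U → P →+* ℝ},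
      (∀ p, Tendsto (fun u => χ u p) l (𝓝 (φ (algebraMap P R p)))) →
      ∀ᶠ u in l, ∃ φ' : R →+* ℝ, ∀ p, φ' (algebraMap P R p) = χ u p := by
  classical
  let L := FractionRing P
  let K := FractionRing R
  have : FaithfulSMul P K := (faithfulSMul_iff_algebraMap_injective P K).2 (by
    rw [IsScalarTower.algebraMap_eq P R K]
    exact (IsFractionRing.injective R K).comp (FaithfulSMul.algebraMap_injective P R))
  let : Algebra L K := FractionRing.liftAlgebra P K
  have : IsScalarTower P L K := FractionRing.isScalarTower_liftAlgebra P K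
  have : Algebra.IsAlgebraic P K := (IsFractionRing.isAlgebraic_iff' P R K).1 inferInstance
  have : Algebra.IsAlgebraic L K := IsFractionRing.comap_isAlgebraic_iff.1 this
  have : CharZero L := charZero_of_injective_algebraMap (IsFractionRing.injective P L)
  have : Algebra.EssFiniteType R K := .of_isLocalization _ (nonZeroDivisors R)
  have : Algebra.EssFiniteType P K := .comp P R K
  have : Algebra.EssFiniteType L K := .of_comp P L K
  have : FiniteDimensional L K := Algebra.finite_of_essFiniteType_of_isAlgebraic
  -- a primitive element, integral over `P`
  obtain ⟨θ, hθint, hθ⟩ : ∃ θ : K, IsIntegral P θ ∧ ∀ z : K, ∃ p : L[X], z = aeval θ p := by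
    obtain ⟨α, hα⟩ := Field.exists_primitive_element L K
    obtain ⟨c, hc, hcα⟩ := IsAlgebraic.exists_integral_multiple (Algebra.IsAlgebraic.isAlgebraic (R := P) α)
    refine ⟨c • α, hcα, fun z => ?_⟩
    have hz : z ∈ Algebra.adjoin L {α} := by
      rw [Algebra.adjoin_eq_top_of_primitive_element (Algebra.IsAlgebraic.isAlgebraic α) hα]
      trivial
    rw [Algebra.adjoin_singleton_eq_range_aeval] at hz
    obtain ⟨p, rfl⟩ := hz
    have hcL : algebraMap P L c ≠ 0 := (map_ne_zero_iff _ (IsFractionRing.injective P L)).2 hc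
    refine ⟨p.comp (C (algebraMap P L c)⁻¹ * X), ?_⟩
    rw [aeval_comp]
    congr 1
    simp only [map_mul, aeval_C, aeval_X, ← algebraMap_smul L c α, Algebra.smul_def, map_inv₀]
    rw [inv_mul_cancel_left₀]
    exact (map_ne_zero_iff _ (algebraMap L K).injective).2 hcL
  have hden : ∀ z : K, ∃ (q : P) (p : P[X]), q ≠ 0 ∧ z * algebraMap P K q = aeval θ p := by
    intro z
    obtain ⟨p, rfl⟩ := hθ z
    obtain ⟨b, hb, hbp⟩ := IsLocalization.integerNormalization_spec (nonZeroDivisors P) p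
    refine ⟨b, IsLocalization.integerNormalization (nonZeroDivisors P) p,
      nonZeroDivisors.ne_zero hb, ?_⟩
    rw [← aeval_map_algebraMap L θ (IsLocalization.integerNormalization _ p), hbp, ← algebraMap_smul L b p, map_smul, Algebra.smul_def,
      ← IsScalarTower.algebraMap_apply, mul_comm]
  set f := minpoly P θ
  have hf0 : aeval θ f = 0 := minpoly.aeval P θ
  have hf' : aeval θ (derivative f) ≠ 0 := by
    have h1 : f.map (algebraMap P L) = minpoly L θ :=
      (minpoly.isIntegrallyClosed_eq_field_fractions' L hθint).symm
    rw [← aeval_map_algebraMap L, ← derivative_map, h1]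
    exact (Algebra.IsSeparable.isSeparable L θ).aeval_derivative_ne_zero (minpoly.aeval L θ)
  choose q p hq hqp using hden
  obtain ⟨G, hG⟩ := (inferInstance : Algebra.FiniteType P R).out
  let Q : P := ∏ g ∈ G, q (algebraMap R K g)
  have hQ : Q ≠ 0 := Finset.prod_ne_zero_iff.2 fun g _ => hq _
  obtain ⟨a₁, s₁, hs₁, h₁⟩ := IsFractionRing.div_surjective R θ
  obtain ⟨a₂, s₂, hs₂, h₂⟩ := IsFractionRing.div_surjective R (aeval θ (derivative f))⁻¹
  have hne : ∀ r : R, r ≠ 0 → algebraMap R K r ≠ 0 := fun r hr =>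
    (map_ne_zero_iff _ (IsFractionRing.injective R K)).2 hr
  have hs₁' := nonZeroDivisors.ne_zero hs₁
  have hs₂' := nonZeroDivisors.ne_zero hs₂
  refine ⟨s₁ * s₂ * algebraMap P R Q, mul_ne_zero (mul_ne_zero hs₁' hs₂')
    ((map_ne_zero_iff _ (FaithfulSMul.algebraMap_injective P R)).2 hQ), ?_⟩
  intro φ hφ U l χ hχ
  simp only [map_mul, mul_ne_zero_iff] at hφ
  obtain ⟨⟨hφ₁, hφ₂⟩, hφQ⟩ := hφ
  set χ₀ : P →+* ℝ := φ.comp (algebraMap P R)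
  -- the value of `θ` at `φ` is a simple root of the specialized minimal polynomial
  obtain ⟨a, ha, ha'⟩ : ∃ a : ℝ, f.eval₂ χ₀ a = 0 ∧ (derivative f).eval₂ χ₀ a ≠ 0 := by
    obtain ⟨O, Φ, hΦ, hO⟩ := exists_extension_to_localSubring (K := K) φ
    have hθO : θ ∈ O := hO θ a₁ s₁ hφ₁ (by rw [← h₁, div_mul_cancel₀ _ (hne _ hs₁')])
    have hiO : (aeval θ (derivative f))⁻¹ ∈ O :=
      hO _ a₂ s₂ hφ₂ (by rw [← h₂, div_mul_cancel₀ _ (hne _ hs₂')])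
    have hPO : ∀ c : P, algebraMap P K c ∈ O := fun c => by
      rw [IsScalarTower.algebraMap_apply P R K]; exact (hΦ _).1
    let j : P →+* O := (algebraMap P K).codRestrict O hPO
    have hj : Φ.comp j = χ₀ := RingHom.ext fun c => by
      have := (hΦ (algebraMap P R c)).2
      simp only [← IsScalarTower.algebraMap_apply P R K] at this
      exact this
    have hval : ∀ g : P[X], ((g.eval₂ j ⟨θ, hθO⟩ : O) : K) = aeval θ g := fun g => by
      rw [← O.coe_subtype, hom_eval₂]; rfl
    have hev : ∀ g : P[X], g.eval₂ χ₀ (Φ ⟨θ, hθO⟩) = Φ (g.eval₂ j ⟨θ, hθO⟩) := fun g => by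
      rw [hom_eval₂, hj]
    refine ⟨Φ ⟨θ, hθO⟩, ?_, fun h => ?_⟩
    · rw [hev, show f.eval₂ j ⟨θ, hθO⟩ = 0 from Subtype.ext (by rw [hval, hf0]; rfl), map_zero]
    · have h3 : (derivative f).eval₂ j ⟨θ, hθO⟩ * ⟨_, hiO⟩ = 1 := Subtype.ext (by
        change (((derivative f).eval₂ j ⟨θ, hθO⟩ : O) : K) * (aeval θ (derivative f))⁻¹ = 1
        rw [hval, mul_inv_cancel₀ hf'])
      have := congrArg Φ h3
      rw [map_mul, map_one, ← hev, h, zero_mul] at this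
      exact zero_ne_one this
  filter_upwards [eventually_exists_root hχ f ha ha', (hχ Q).eventually_ne hφQ] with u ⟨b, hb⟩ hu
  -- extend `χ u` to `P[θ]` by sending `θ` to the root `b`, and then to `R`
  let ψ : Algebra.adjoin P {θ} →+* ℝ :=
    (AdjoinRoot.lift (χ u) b hb).comp (minpoly.equivAdjoin hθint).symm.toRingEquiv.toRingHom
  have hψ : ∀ c, ψ (algebraMap P _ c) = χ u c := fun c => by
    change AdjoinRoot.lift (χ u) b hb ((minpoly.equivAdjoin hθint).symm (algebraMap P _ c)) = _
    rw [AlgEquiv.commutes]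
    exact AdjoinRoot.lift_of hb
  obtain ⟨O, Ψ, hΨ, hO⟩ := exists_extension_to_localSubring (K := K) ψ
  have hPO : ∀ c : P, algebraMap P K c ∈ O := fun c => (hΨ (algebraMap P _ c)).1
  have hRO : ∀ r : R, algebraMap R K r ∈ O := by
    intro r
    have hr : r ∈ Algebra.adjoin P (G : Set R) := by rw [hG]; trivial
    induction hr using Algebra.adjoin_induction with
    | mem g hg =>
      refine hO _ ⟨aeval θ (p (algebraMap R K g)), ?_⟩ (algebraMap P _ (q (algebraMap R K g))) ?_
        (hqp _)
      · rw [Algebra.adjoin_singleton_eq_range_aeval]; exact ⟨_, rfl⟩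
      · rw [hψ]
        exact fun h => hu (by
          rw [map_prod]; exact Finset.prod_eq_zero hg h)
    | algebraMap c => rw [← IsScalarTower.algebraMap_apply]; exact hPO c
    | add x y _ _ hx hy => rw [map_add]; exact O.add_mem hx hy
    | mul x y _ _ hx hy => rw [map_mul]; exact O.mul_mem hx hy
  refine ⟨Ψ.comp ((algebraMap R K).codRestrict O hRO), fun c => ?_⟩
  have := (hΨ (algebraMap P _ c)).2
  rw [hψ] at this
  rw [← this]
  exact congrArg Ψ (Subtype.ext (IsScalarTower.algebraMap_apply P R K c).symm)

end Lifting

/-! ### Images of real algebraic sets -/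

/-- Algebraically independent elements of a finitely generated real domain are, away from a
hypersurface, the coordinates of an open map on real points. -/
theorem exists_open_of_algebraicIndependent {ι : Type} {R : Type*} [CommRing R] [IsDomain R]
    [Algebra ℝ R] [Algebra.FiniteType ℝ R] {y : ι → R} (hy : AlgebraicIndependent ℝ y) :
    ∃ s : R, s ≠ 0 ∧ ∀ φ : R →+* ℝ, φ s ≠ 0 →
      ∀ᶠ u in 𝓝 (fun i => φ (y i)), ∃ φ' : R →+* ℝ, ∀ i, φ' (y i) = u i := by
  obtain ⟨T, hyT, hT⟩ := exists_isTranscendenceBasis_superset (R := ℝ) hy.coe_range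
  let P := Algebra.adjoin ℝ (Set.range ((↑) : T → R))
  have : Algebra.IsAlgebraic P R := hT.isAlgebraic
  let e : MvPolynomial T ℝ ≃ₐ[ℝ] P := hT.1.aevalEquiv
  have : IsIntegrallyClosed P := IsIntegrallyClosed.of_equiv e.toRingEquiv
  have : CharZero P := charZero_of_injective_ringHom (f := (e : MvPolynomial T ℝ →+* P)) e.injective
  have : Algebra.FiniteType P R := .of_restrictScalars_finiteType ℝ P R
  have he : ∀ p, algebraMap P R (e p) = MvPolynomial.aeval (fun τ : T => (τ : R)) p :=
    fun p => hT.1.algebraMap_aevalEquiv p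
  obtain ⟨s, hs, h⟩ := exists_extension_of_isAlgebraic (P := P) (R := R)
  refine ⟨s, hs, fun φ hφ => ?_⟩
  let z : ι → T := fun i => ⟨y i, hyT ⟨i, rfl⟩⟩
  have hz : Function.Injective z := fun i j hij => hy.injective (congrArg Subtype.val hij)
  -- only the coordinates belonging to `y` vary, the others keep their values at `φ`
  let t : (ι → ℝ) → T → ℝ := fun u => Function.extend z u fun τ : T => φ (τ : R)
  have ht : Continuous t := by
    refine continuous_pi fun τ => ?_
    by_cases hτ : ∃ i, z i = τ
    · obtain ⟨i, rfl⟩ := hτ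
      simpa [t, hz.extend_apply] using continuous_apply i
    · simpa [t, Function.extend_apply' _ _ _ hτ] using continuous_const
  have ht₀ : t (fun i => φ (y i)) = fun τ : T => φ (τ : R) := by
    funext τ
    by_cases hτ : ∃ i, z i = τ
    · obtain ⟨i, rfl⟩ := hτ
      simp [t, hz.extend_apply, z]
    · simp [t, Function.extend_apply' _ _ _ hτ]
  let χ : (ι → ℝ) → P →+* ℝ := fun u => (MvPolynomial.eval (t u)).comp e.symm.toRingEquiv.toRingHom
  have hχe : ∀ u p, χ u (e p) = MvPolynomial.eval (t u) p := fun u p => by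
    change MvPolynomial.eval (t u) (e.symm (e p)) = _
    rw [AlgEquiv.symm_apply_apply]
  have hφe : ∀ p, φ (MvPolynomial.aeval (fun τ : T => (τ : R)) p) =
      MvPolynomial.eval (fun τ : T => φ (τ : R)) p := by
    have : (φ.comp (MvPolynomial.aeval (fun τ : T => (τ : R))).toRingHom) =
        MvPolynomial.eval (fun τ : T => φ (τ : R)) := by
      refine MvPolynomial.ringHom_ext (fun r => ?_) fun τ => by simp
      have : φ.comp (algebraMap ℝ R) = RingHom.id ℝ := Subsingleton.elim _ _
      have hr : φ (algebraMap ℝ R r) = r := RingHom.congr_fun this r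
      change φ (MvPolynomial.aeval _ (MvPolynomial.C r)) = _
      rw [MvPolynomial.aeval_C, hr, MvPolynomial.eval_C]
    exact fun p => RingHom.congr_fun this p
  have key := h φ hφ (l := 𝓝 (fun i => φ (y i))) (χ := χ) fun p => by
    obtain ⟨p, rfl⟩ := e.surjective p
    simp only [hχe, he, hφe, ← ht₀]
    exact ((MvPolynomial.continuous_eval p).comp ht).tendsto _
  filter_upwards [key] with u ⟨φ', hφ'⟩
  refine ⟨φ', fun i => ?_⟩
  have := hφ' (e (MvPolynomial.X (z i)))
  rw [he, hχe, MvPolynomial.aeval_X, MvPolynomial.eval_X] at this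
  rw [show y i = z i from rfl, this]
  exact hz.extend_apply _ _ _

/-- The real zero set of an ideal of polynomials. -/
def realZeros {σ : Type} (J : Ideal (MvPolynomial σ ℝ)) : Set (σ → ℝ) :=
  {a | ∀ p ∈ J, MvPolynomial.eval a p = 0}

theorem realZeros_anti {σ : Type} {I J : Ideal (MvPolynomial σ ℝ)} (h : I ≤ J) :
    realZeros J ⊆ realZeros I := fun _ ha p hp => ha p (h hp)

theorem mem_realZeros_sup_span {σ : Type} {J : Ideal (MvPolynomial σ ℝ)} {s : MvPolynomial σ ℝ}
    {a : σ → ℝ} (ha : a ∈ realZeros J) (hs : MvPolynomial.eval a s = 0) :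
    a ∈ realZeros (J ⊔ Ideal.span {s}) := by
  have : J ⊔ Ideal.span {s} ≤ RingHom.ker (MvPolynomial.eval a) := by
    refine sup_le (fun p hp => ha p hp) ?_
    rw [Ideal.span_le, Set.singleton_subset_iff]
    exact hs
  exact fun p hp => this hp

/-- The map between real affine spaces with polynomial coordinates `π i`. -/
noncomputable def polyMap {σ ι : Type} (π : ι → MvPolynomial σ ℝ) (a : σ → ℝ) : ι → ℝ :=
  fun i => MvPolynomial.eval a (π i)

theorem eval_aeval_polyMap {σ ι : Type} (π : ι → MvPolynomial σ ℝ) (a : σ → ℝ)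
    (g : MvPolynomial ι ℝ) :
    MvPolynomial.eval a (MvPolynomial.aeval π g) = MvPolynomial.eval (polyMap π a) g := by
  induction g using MvPolynomial.induction_on with
  | C r => simp
  | add p q hp hq => simp only [map_add, hp, hq]
  | mul_X p i hp => simp only [map_mul, hp, MvPolynomial.aeval_X, MvPolynomial.eval_X, polyMap]

/-- On the zero set of a prime ideal, a polynomial map is open away from a smaller zero set,
unless its image lies in a hypersurface. -/
theorem exists_open_or_image_subset_of_isPrime {σ ι : Type} [Finite σ]
    (π : ι → MvPolynomial σ ℝ) (J : Ideal (MvPolynomial σ ℝ)) [J.IsPrime] :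
    (∃ s ∉ J, ∀ a ∈ realZeros J, MvPolynomial.eval a s ≠ 0 →
      polyMap π a ∈ interior (polyMap π '' realZeros J)) ∨
    ∃ g : MvPolynomial ι ℝ, g ≠ 0 ∧
      ∀ a ∈ realZeros J, MvPolynomial.eval (polyMap π a) g = 0 := by
  let y : ι → MvPolynomial σ ℝ ⧸ J := fun i => Ideal.Quotient.mk J (π i)
  have hy : ∀ g, MvPolynomial.aeval y g = Ideal.Quotient.mk J (MvPolynomial.aeval π g) := fun g =>
    (MvPolynomial.comp_aeval_apply π (Ideal.Quotient.mkₐ ℝ J) g).symm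
  by_cases hind : AlgebraicIndependent ℝ y
  · left
    obtain ⟨s, hs, h⟩ := exists_open_of_algebraicIndependent hind
    obtain ⟨s, rfl⟩ := Ideal.Quotient.mk_surjective s
    refine ⟨s, fun h => hs (Ideal.Quotient.eq_zero_iff_mem.2 h), fun a ha has => ?_⟩
    rw [mem_interior_iff_mem_nhds]
    filter_upwards [h (Ideal.Quotient.lift J (MvPolynomial.eval a) ha) has] with u ⟨φ, hφ⟩
    -- the point of the zero set which corresponds to the homomorphism `φ`
    let b : σ → ℝ := fun j => φ (Ideal.Quotient.mk J (MvPolynomial.X j))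
    have hb : φ.comp (Ideal.Quotient.mk J) = MvPolynomial.eval b := by
      refine MvPolynomial.ringHom_ext (fun r => ?_) fun j => by simp [b]
      have : (φ.comp (Ideal.Quotient.mk J)).comp MvPolynomial.C = RingHom.id ℝ :=
        Subsingleton.elim _ _
      exact (RingHom.congr_fun this r).trans (MvPolynomial.eval_C r).symm
    refine ⟨b, fun p hp => ?_, funext fun i => ?_⟩
    · rw [← hb, RingHom.comp_apply, Ideal.Quotient.eq_zero_iff_mem.2 hp, map_zero]
    · rw [polyMap, ← hb]; exact hφ i
  · right
    rw [algebraicIndependent_iff] at hind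
    push Not at hind
    obtain ⟨g, hg, hg0⟩ := hind
    refine ⟨g, hg0, fun a ha => ?_⟩
    rw [← eval_aeval_polyMap]
    exact ha _ (Ideal.Quotient.eq_zero_iff_mem.1 (by rw [← hy, hg]))

/-- The image of a real algebraic set under a polynomial map lies in its interior, up to a
hypersurface. The proof is by Noetherian induction on the ideal of the algebraic set. -/
theorem exists_mem_interior_image_or_eval_eq_zero {σ ι : Type} [Finite σ]
    (π : ι → MvPolynomial σ ℝ) (J : Ideal (MvPolynomial σ ℝ)) :
    ∃ g : MvPolynomial ι ℝ, g ≠ 0 ∧ ∀ a ∈ realZeros J,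
      polyMap π a ∈ interior (polyMap π '' realZeros J) ∨
        MvPolynomial.eval (polyMap π a) g = 0 := by
  induction J using WellFoundedGT.induction with
  | ind J ih =>
    have hmono : ∀ {I}, J ≤ I → interior (polyMap π '' realZeros I) ⊆
        interior (polyMap π '' realZeros J) := fun h =>
      interior_mono (Set.image_mono (realZeros_anti h))
    have hlt : ∀ {s}, s ∉ J → J < J ⊔ Ideal.span {s} := fun {s} hs =>
      lt_of_le_of_ne le_sup_left fun h => hs (by
        rw [h]; exact Ideal.mem_sup_right (Ideal.mem_span_singleton_self s))
    by_cases hJ : J.IsPrime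
    · rcases exists_open_or_image_subset_of_isPrime π J with ⟨s, hs, h⟩ | ⟨g, hg, h⟩
      · obtain ⟨g, hg, hg'⟩ := ih _ (hlt hs)
        refine ⟨g, hg, fun a ha => ?_⟩
        by_cases has : MvPolynomial.eval a s = 0
        · exact (hg' a (mem_realZeros_sup_span ha has)).imp_left (hmono le_sup_left ·)
        · exact Or.inl (h a ha has)
      · exact ⟨g, hg, fun a ha => Or.inr (h a ha)⟩
    · by_cases htop : J = ⊤
      · exact ⟨1, one_ne_zero, fun a ha => absurd (ha 1 (by rw [htop]; trivial)) (by simp)⟩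
      · rw [Ideal.not_isPrime_iff] at hJ
        obtain ⟨s, hs, t, ht, hst⟩ := hJ.resolve_left htop
        obtain ⟨g, hg, hg'⟩ := ih _ (hlt hs)
        obtain ⟨k, hk, hk'⟩ := ih _ (hlt ht)
        refine ⟨g * k, mul_ne_zero hg hk, fun a ha => ?_⟩
        have := ha _ hst
        rw [map_mul, mul_eq_zero] at this
        rw [map_mul, mul_eq_zero]
        rcases this with h | h
        · rcases hg' a (mem_realZeros_sup_span ha h) with h' | h'
          exacts [Or.inl (hmono le_sup_left h'), Or.inr (Or.inl h')]
        · rcases hk' a (mem_realZeros_sup_span ha h) with h' | h'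
          exacts [Or.inl (hmono le_sup_left h'), Or.inr (Or.inr h')]

/-- The real zero set of a nonzero polynomial has empty interior. -/
theorem interior_setOf_eval_eq_zero {ι : Type} [Finite ι] {g : MvPolynomial ι ℝ} (hg : g ≠ 0) :
    interior {v : ι → ℝ | MvPolynomial.eval v g = 0} = ∅ := by
  rw [Set.eq_empty_iff_forall_notMem]
  intro v hv
  rw [mem_interior_iff_mem_nhds, nhds_pi, Filter.mem_pi] at hv
  obtain ⟨I, -, t, ht, hsub⟩ := hv
  refine hg (MvPolynomial.funext_set t (fun i => infinite_of_mem_nhds _ (ht i)) fun x hx => ?_)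
  rw [map_zero]
  exact hsub fun i _ => hx i trivial

/-- If the image of a real algebraic set under a polynomial map is dense in an open set, then its
interior is dense there too. -/
theorem interior_closure_image_subset {σ ι : Type} [Finite σ] [Finite ι]
    (π : ι → MvPolynomial σ ℝ) (J : Ideal (MvPolynomial σ ℝ)) :
    interior (closure (polyMap π '' realZeros J)) ⊆
      closure (interior (polyMap π '' realZeros J)) := by
  obtain ⟨g, hg, h⟩ := exists_mem_interior_image_or_eval_eq_zero π J
  set S := polyMap π '' realZeros J
  have hcl : closure S ⊆ closure (interior S) ∪ {v | MvPolynomial.eval v g = 0} := by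
    refine closure_minimal ?_ (isClosed_closure.union
      (isClosed_eq (MvPolynomial.continuous_eval g) continuous_const))
    rintro _ ⟨a, ha, rfl⟩
    exact (h a ha).imp_left (subset_closure ·)
  intro v hv
  by_contra hv'
  have : v ∈ interior {v : ι → ℝ | MvPolynomial.eval v g = 0} := by
    rw [mem_interior_iff_mem_nhds]
    filter_upwards [isOpen_interior.mem_nhds hv, isClosed_closure.isOpen_compl.mem_nhds hv']
      with w hw hw'
    exact (hcl (interior_subset hw)).resolve_left hw'
  rwa [interior_setOf_eval_eq_zero hg] at this

/-! ### Filtrations by sums with a spanning set -/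

section Filtration

variable {E : Type*} [AddCommGroup E] [Module ℝ E] [TopologicalSpace E] [IsTopologicalAddGroup E]

/-- Suppose that `A + ℝ • C ⊆ B`, that `C` spans the space, and that `B \ A` has empty interior.
Then the closure of the interior of `A` is stable under translation by `C`, hence by every vector,
so it is the whole space. -/
theorem dense_interior_of_interior_diff_eq_empty {A B C : Set E}
    (hA : interior (closure A) ⊆ closure (interior A)) (hne : (interior A).Nonempty)
    (hC : Submodule.span ℝ C = ⊤) (hAB : ∀ v ∈ A, ∀ x ∈ C, ∀ c : ℝ, v + c • x ∈ B)
    (hBA : interior (B \ A) = ∅) : Dense (interior A) := by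
  have h1 : ∀ v ∈ interior A, ∀ x ∈ C, ∀ c : ℝ, v + c • x ∈ closure (interior A) := by
    intro v hv x hx c
    refine hA (mem_interior_iff_mem_nhds.2 ?_)
    have hopen : IsOpen {w | w - c • x ∈ interior A} :=
      isOpen_interior.preimage (continuous_id.sub continuous_const)
    have hsub : {w | w - c • x ∈ interior A} ⊆ closure A := by
      intro w hw
      by_contra hw'
      have : w ∈ interior (B \ A) := mem_interior_iff_mem_nhds.2 <| by
        filter_upwards [hopen.mem_nhds hw, isClosed_closure.isOpen_compl.mem_nhds hw'] with u hu hu'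
        refine ⟨?_, fun h => hu' (subset_closure h)⟩
        simpa using hAB _ (interior_subset hu) x hx c
      rwa [hBA] at this
    exact Filter.mem_of_superset (hopen.mem_nhds (by simpa using hv)) hsub
  have h2 : ∀ x ∈ C, ∀ v ∈ closure (interior A), ∀ c : ℝ, v + c • x ∈ closure (interior A) := by
    intro x hx v hv c
    rw [← closure_closure]
    exact map_mem_closure (f := fun w => w + c • x) (continuous_id.add continuous_const) hv fun w hw => h1 w hw x hx c
  have h3 : ∀ w ∈ Submodule.span ℝ C, ∀ v ∈ closure (interior A), ∀ c : ℝ,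
      v + c • w ∈ closure (interior A) := by
    intro w hw
    induction hw using Submodule.span_induction with
    | mem x hx => exact h2 x hx
    | zero => intro v hv c; simpa using hv
    | add x y _ _ hx hy =>
      intro v hv c
      rw [smul_add, ← add_assoc]
      exact hy _ (hx _ hv c) c
    | smul a x _ hx =>
      intro v hv c
      rw [smul_smul]
      exact hx v hv _
  obtain ⟨v, hv⟩ := hne
  intro z
  simpa using h3 (z - v) (by rw [hC]; trivial) v (subset_closure hv) 1

/-- Consider an increasing sequence of sets `S k` which exhausts the space, such that each `S k` is
dense only where its interior is, and `S k + ℝ • C ⊆ S (k + 1)` for a spanning set `C`. The indices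
`r` for which an open set of points lies in `S r` and not earlier form a nonempty interval. -/
theorem exists_isLeast_isGreatest_of_filtration [Nonempty E] {S : ℕ → Set E} (hmono : Monotone S)
    {n : ℕ} (hn : S n = Set.univ) (hS : ∀ k, interior (closure (S k)) ⊆ closure (interior (S k)))
    {C : Set E} (hC : Submodule.span ℝ C = ⊤)
    (hadd : ∀ k, ∀ v ∈ S k, ∀ x ∈ C, ∀ c : ℝ, v + c • x ∈ S (k + 1)) {T : Set ℕ}
    (hT : ∀ r, r ∈ T ↔ (interior {v | v ∈ S r ∧ ∀ j < r, v ∉ S j}).Nonempty) :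
    ∃ l h, IsLeast T l ∧ IsGreatest T h ∧ ∀ r, l ≤ r → r ≤ h → r ∈ T := by
  classical
  have hex : ∃ k, (interior (S k)).Nonempty := ⟨n, by simp [hn]⟩
  have hsucc : ∀ k, {v | v ∈ S (k + 1) ∧ ∀ j < k + 1, v ∉ S j} = S (k + 1) \ S k := fun k =>
    Set.ext fun v => and_congr_right fun _ =>
      ⟨fun h => h k k.lt_succ_self, fun h j hj hv => h (hmono (Nat.le_of_lt_succ hj) hv)⟩
  set l := Nat.find hex with hl
  have hlT : l ∈ T := by
    rw [hT]
    have hne := Nat.find_spec hex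
    rw [← hl] at hne
    clear_value l
    cases l with
    | zero => simpa using hne
    | succ k =>
      have hk : interior (S k) = ∅ := Set.not_nonempty_iff_eq_empty.1
        (Nat.find_min hex (by rw [← hl]; exact k.lt_succ_self))
      have hk' : interior (closure (S k)) = ∅ := by
        have := hS k
        rwa [hk, closure_empty, Set.subset_empty_iff] at this
      rw [hsucc]
      obtain ⟨v, hv, hv'⟩ : ∃ v ∈ interior (S (k + 1)), v ∉ closure (S k) := by
        by_contra! h
        have h' := interior_maximal h isOpen_interior
        rw [hk'] at h'
        exact hne.ne_empty (Set.subset_empty_iff.1 h')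
      refine ⟨v, mem_interior_iff_mem_nhds.2 ?_⟩
      filter_upwards [isOpen_interior.mem_nhds hv, isClosed_closure.isOpen_compl.mem_nhds hv']
        with w hw hw'
      exact ⟨interior_subset hw, fun h => hw' (subset_closure h)⟩
  have hle : ∀ r ∈ T, l ≤ r := fun r hr =>
    Nat.find_min' hex (((hT r).1 hr).mono (interior_mono fun v hv => hv.1))
  have hbdd : BddAbove T := ⟨n, fun r hr => by
    by_contra! h
    obtain ⟨v, hv⟩ := (hT r).1 hr
    exact (interior_subset hv).2 n h (by rw [hn]; trivial)⟩
  have hsup : sSup T ∈ T := Nat.sSup_mem ⟨l, hlT⟩ hbdd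
  refine ⟨l, sSup T, ⟨hlT, hle⟩, ⟨hsup, fun r hr => le_csSup hbdd hr⟩, fun r hlr hrh => ?_⟩
  rcases hlr.eq_or_lt with rfl | hlr
  · exact hlT
  obtain ⟨k, rfl⟩ : ∃ k, r = k + 1 := ⟨r - 1, by omega⟩
  by_contra hr
  rw [hT, hsucc, Set.not_nonempty_iff_eq_empty] at hr
  have hdense := dense_interior_of_interior_diff_eq_empty (hS k)
    ((Nat.find_spec hex).mono (interior_mono (hmono (Nat.le_of_lt_succ hlr)))) hC (hadd k) hr
  obtain ⟨v, hv, hvk⟩ := hdense.inter_open_nonempty _ isOpen_interior ((hT _).1 hsup)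
  exact (interior_subset hv).2 k hrh (interior_subset hvk)

end Filtration

/-! ### Ranks with respect to a projective variety -/

section Rank

variable {N : ℕ} {X : Set (ProjSpace N)}

theorem zero_mem_cone : (0 : Vec N) ∈ cone X := fun h => absurd rfl h

theorem HasDecomposition.add_smul {k : ℕ} {v x : Vec N} (h : HasDecomposition X k v)
    (hx : x ∈ cone X) (c : ℝ) : HasDecomposition X (k + 1) (v + c • x) := by
  obtain ⟨a, y, hy, rfl⟩ := h
  refine ⟨Fin.snoc a c, Fin.snoc y x, fun i => ?_, by simp [Fin.sum_univ_castSucc]⟩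
  refine Fin.lastCases ?_ (fun i => ?_) i
  · simpa using hx
  · simpa using hy i

theorem monotone_hasDecomposition : Monotone fun k => {v | HasDecomposition X k v} :=
  monotone_nat_of_le_succ fun k v (h : HasDecomposition X k v) => by
    simpa using h.add_smul zero_mem_cone 0

theorem vecRank_le_iff {k : ℕ} {v : Vec N} : vecRank X v ≤ k ↔ HasDecomposition X k v := by
  refine ⟨fun h => ?_, fun h => iInf₂_le k h⟩
  by_contra hv
  have : ((k + 1 : ℕ) : ℕ∞) ≤ vecRank X v := le_iInf₂ fun j hj => by
    by_contra! hlt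
    exact hv (monotone_hasDecomposition (Nat.le_of_lt_succ (by exact_mod_cast hlt)) hj)
  have := this.trans h
  norm_cast at this
  omega

theorem vecRank_eq_iff {r : ℕ} {v : Vec N} :
    vecRank X v = r ↔ HasDecomposition X r v ∧ ∀ j < r, ¬ HasDecomposition X j v := by
  simp only [← vecRank_le_iff, not_le]
  refine ⟨fun h => ⟨h.le, fun j hj => by rw [h]; exact_mod_cast hj⟩, fun ⟨h, h'⟩ => ?_⟩
  refine le_antisymm h (le_of_not_gt fun hlt => ?_)
  obtain ⟨j, hj⟩ := ENat.ne_top_iff_exists.1 (ne_top_of_lt hlt)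
  rw [← hj] at hlt h'
  exact lt_irrefl _ (h' j (by exact_mod_cast hlt))

/-- A rank is typical in projective space exactly when it is attained on a nonempty open set of
vectors: an open cone can be passed to the quotient, and removing the origin from a nonempty open
set leaves a nonempty open set. -/
theorem isTypicalRank_iff {r : ℕ} :
    IsTypicalRank X r ↔ (interior {v : Vec N | vecRank X v = r}).Nonempty := by
  constructor
  · rintro ⟨p, hp⟩
    have hcont : Continuous (Projectivization.mk' ℝ : {v : Vec N // v ≠ 0} → ProjSpace N) :=
      continuous_coinduced_rng
    have hopen : IsOpen ((↑) '' (Projectivization.mk' ℝ ⁻¹'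
        interior {p : ProjSpace N | rank X p = r} : Set {v : Vec N // v ≠ 0}) : Set (Vec N)) :=
      isOpen_ne.isOpenMap_subtype_val _ (isOpen_interior.preimage hcont)
    induction p using Projectivization.ind with
    | h v hv =>
      refine ⟨v, interior_maximal ?_ hopen ⟨⟨v, hv⟩, hp, rfl⟩⟩
      rintro _ ⟨w, hw, rfl⟩
      exact interior_subset (s := {p : ProjSpace N | rank X p = r}) hw
  · rintro ⟨v, hv⟩
    set W := interior {v : Vec N | vecRank X v = r}
    obtain ⟨w, hwW, hw0⟩ : ∃ w ∈ W, w ≠ 0 := by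
      obtain ⟨w, hw, hw'⟩ := (dense_compl_singleton (0 : Vec N)).inter_open_nonempty W
        isOpen_interior ⟨v, hv⟩
      exact ⟨w, hw, hw'⟩
    let V : Set (ProjSpace N) := {p | ∃ (w : Vec N) (hw : w ≠ 0), w ∈ W ∧
      Projectivization.mk ℝ w hw = p}
    have hV : IsOpen V := by
      rw [isOpen_coinduced]
      have : (Projectivization.mk' ℝ : {v : Vec N // v ≠ 0} → ProjSpace N) ⁻¹' V =
          ⋃ t : ℝˣ, {u : {v : Vec N // v ≠ 0} | t • (u : Vec N) ∈ W} := by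
        ext u
        simp only [Set.mem_preimage, Set.mem_iUnion, Set.mem_ofPred_eq, V,
          Projectivization.mk'_eq_mk, Projectivization.mk_eq_mk_iff]
        constructor
        · rintro ⟨w, hw, hwW, t, rfl⟩
          exact ⟨t, hwW⟩
        · rintro ⟨t, ht⟩
          exact ⟨t • (u : Vec N), (smul_ne_zero_iff_ne t).2 u.2, ht, t, rfl⟩
      rw [this]
      refine isOpen_iUnion fun t => isOpen_interior.preimage ?_
      exact continuous_subtype_val.const_smul t
    refine ⟨Projectivization.mk ℝ w hw0, interior_maximal ?_ hV ⟨w, hw0, hwW, rfl⟩⟩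
    rintro _ ⟨u, hu, huW, rfl⟩
    exact interior_subset (s := {v : Vec N | vecRank X v = r}) huW

theorem span_cone_eq_top (hnd : IsNondegenerate X) : Submodule.span ℝ (cone X) = ⊤ := by
  by_contra h
  obtain ⟨φ, hφ, hle⟩ := Submodule.exists_le_ker_of_lt_top _ (lt_top_iff_ne_top.2 h)
  obtain ⟨v, hv, hv'⟩ := hnd φ hφ
  exact hv' (hle (Submodule.subset_span hv))

/-- The cone over a nondegenerate `X` contains a basis, which bounds the rank. -/
theorem exists_forall_hasDecomposition (hnd : IsNondegenerate X) :
    ∃ n, {v | HasDecomposition X n v} = Set.univ := by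
  obtain ⟨f, hf, hspan, -⟩ := Submodule.exists_fun_fin_finrank_span_eq ℝ (cone X)
  refine ⟨Module.finrank ℝ (Submodule.span ℝ (cone X)), Set.eq_univ_of_forall fun v => ?_⟩
  have hv : v ∈ Submodule.span ℝ (Set.range f) := by
    rw [hspan, span_cone_eq_top hnd]; trivial
  obtain ⟨c, rfl⟩ := (Submodule.mem_span_range_iff_exists_fun ℝ).1 hv
  exact ⟨c, f, hf, rfl⟩

theorem mem_realZeros_span {σ : Type} {G : Set (MvPolynomial σ ℝ)} {a : σ → ℝ} :
    a ∈ realZeros (Ideal.span G) ↔ ∀ p ∈ G, MvPolynomial.eval a p = 0 := by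
  refine ⟨fun h p hp => h p (Ideal.subset_span hp), fun h => ?_⟩
  have : Ideal.span G ≤ RingHom.ker (MvPolynomial.eval a) := Ideal.span_le.2 h
  exact fun p hp => this hp

/-- The vectors of rank at most `k` are the image of a real algebraic set, that of all scalars
and `k`-tuples of points of the cone, under a polynomial map. -/
theorem exists_setOf_hasDecomposition_eq_image (hX : IsProjectiveVariety X) (k : ℕ) :
    ∃ (π : Fin (N + 1) → MvPolynomial (Fin k ⊕ Fin k × Fin (N + 1)) ℝ) (J : Ideal _),
      {v | HasDecomposition X k v} = polyMap π '' realZeros J := by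
  obtain ⟨F, -, hF⟩ := hX
  -- the factor `v j` makes the origin a zero even if `F` contains nonzero constants
  have hcone : ∀ v : Vec N, v ∈ cone X ↔ ∀ f ∈ F, ∀ j, MvPolynomial.eval v f * v j = 0 := by
    intro v
    constructor
    · intro hv f hf j
      by_cases h0 : v = 0
      · simp [h0]
      · rw [(hF v h0).1 (hv h0) f hf, zero_mul]
    · intro h h0
      obtain ⟨j, hj⟩ := Function.ne_iff.1 h0
      exact (hF v h0).2 fun f hf => (mul_eq_zero.1 (h f hf j)).resolve_right hj
  refine ⟨fun m => ∑ i, MvPolynomial.X (Sum.inl i) * MvPolynomial.X (Sum.inr (i, m)),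
    Ideal.span {p | ∃ f ∈ F, ∃ i j, p =
      MvPolynomial.rename (fun m => Sum.inr (i, m)) f * MvPolynomial.X (Sum.inr (i, j))}, ?_⟩
  ext v
  simp only [Set.mem_ofPred_eq, Set.mem_image, mem_realZeros_span]
  constructor
  · rintro ⟨c, x, hx, rfl⟩
    refine ⟨Sum.elim c fun q => x q.1 q.2, ?_, ?_⟩
    · rintro _ ⟨f, hf, i, j, rfl⟩
      rw [map_mul, MvPolynomial.eval_rename, MvPolynomial.eval_X]
      exact (hcone _).1 (hx i) f hf j
    · funext m
      simp [polyMap]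
  · rintro ⟨a, ha, rfl⟩
    refine ⟨fun i => a (Sum.inl i), fun i m => a (Sum.inr (i, m)), fun i => ?_, ?_⟩
    · refine (hcone _).2 fun f hf j => ?_
      have := ha _ ⟨f, hf, i, j, rfl⟩
      rwa [map_mul, MvPolynomial.eval_rename, MvPolynomial.eval_X] at this
    · funext m
      simp [polyMap]

end Rank

end RealRank

theorem theorem1p1 (N : ℕ) (X : Set (RealRank.ProjSpace N))
    (hX : RealRank.IsProjectiveVariety X) (hnd : RealRank.IsNondegenerate X) :
    ∃ l h : ℕ, IsLeast {r : ℕ | RealRank.IsTypicalRank X r} l ∧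
      IsGreatest {r : ℕ | RealRank.IsTypicalRank X r} h ∧
      ∀ r : ℕ, l ≤ r → r ≤ h → RealRank.IsTypicalRank X r := by
  obtain ⟨n, hn⟩ := RealRank.exists_forall_hasDecomposition hnd
  refine RealRank.exists_isLeast_isGreatest_of_filtration
    (RealRank.monotone_hasDecomposition (X := X)) hn (fun k => ?_)
    (RealRank.span_cone_eq_top hnd) (fun k v hv x hx c => hv.add_smul hx c) fun r => ?_
  · obtain ⟨π, J, h⟩ := RealRank.exists_setOf_hasDecomposition_eq_image hX k
    simp only [h]
    exact RealRank.interior_closure_image_subset π J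
  · simp only [Set.mem_ofPred_eq, RealRank.isTypicalRank_iff, RealRank.vecRank_eq_iff]
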